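/- Let $A$ be a finite alphabet with at least two letters. A configuration is a pair of words $\langle u|v\rangle$ with $u,v\in A^*$. The atomic operations are the letters $a\in A$, the backspace $\leftarrow$, the left arrow $\blacktriangleleft$ and the right arrow $\blacktriangleright$. They act on configurations by $\langle u|v\rangle\cdot a=\langle ua|v\rangle$, $\langle u'a|v\rangle\cdot{\leftarrow}=\langle u'|v\rangle$, $\langle u'a|v\rangle\cdot{\blacktriangleleft}=\langle u'|av\rangle$, $\langle u|av'\rangle\cdot{\blacktriangleright}=\langle ua|v'\rangle$, and $\leftarrow$ and $\blacktriangleleft$ (resp. $\blacktriangleright$) leave $\langle\varepsilon|v\rangle$ (resp. $\langle u|\varepsilon\rangle$) unchanged. A key is a finite word of atomic operations, acting by applying its operations in order. An automatic keyboard is a finite set $K$ of keys; its language $L(K)$ is the set of words $uv$ such that $\langle\varepsilon|\varepsilon\rangle\cdot t_1\cdots t_n=\langle u|v\rangle$ for some $n\ge 1$ and $t_1,\dots,t_n\in K$. An $\mathsf{LK}$ keyboard is an automatic keyboard whose keys contain only letters and $\blacktriangleleft$. Then the following problem is undecidable: given two $\mathsf{LK}$ keyboards $K_1,K_2$ over $A$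 (each presented as a finite list of keys), is $L(K_1)\cap L(K_2)$ empty? -/

import Mathlib

/-! Keyboards: words are edited through a cursor by finite sequences of elementary operations. -/

namespace Keyboard

/-- The atomic operations over an alphabet `A`: writing a letter, the backspace, the left arrow and
the right arrow. -/
inductive Atom (A : Type*) where
  | letter (a : A) : Atom A
  | backspace : Atom A
  | left : Atom A
  | right : Atom A

/-- A key is a finite word of atomic operations. -/
abbrev Key (A : Type*) := List (Atom A)

/-- A configuration `⟨u|v⟩`: the word `u` to the left and the word `v` to the right of the cursor,
both read from left to right. -/
@[ext]
structure Config (A : Type*) where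
  u : List A
  v : List A

/-- The empty configuration. -/
def Config.empty (A : Type*) : Config A := ⟨[], []⟩

/-- The action of an atomic operation; backspace and arrows have no effect when the word on which
they operate is empty. -/
def Config.step {A : Type*} (c : Config A) : Atom A → Config A
  | .letter a => ⟨c.u ++ [a], c.v⟩
  | .backspace => ⟨c.u.dropLast, c.v⟩
  | .left =>
    match c.u.getLast? with
    | none => c
    | some a => ⟨c.u.dropLast, a :: c.v⟩
  | .right =>
    match c.v with
    | [] => c
    | a :: v' => ⟨c.u ++ [a], v'⟩

/-- The action of a key on a configuration. -/
def Config.act {A : Type*} (c : Config A) (t : Key A) : Config A :=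
  t.foldl Config.step c

/-- The action of a sequence of keys on a configuration. -/
def Config.actSeq {A : Type*} (c : Config A) (τ : List (Key A)) : Config A :=
  τ.foldl Config.act c

/-- An automatic keyboard is a finite set of keys. -/
abbrev AutomaticKeyboard (A : Type*) := Finset (Key A)

/-- The language of an automatic keyboard: the words `uv` such that some nonempty sequence of keys
of `K` leads from the empty configuration to `⟨u|v⟩`. -/
def AutomaticKeyboard.language {A : Type*} (K : AutomaticKeyboard A) : Language A :=
  {w | ∃ τ : List (Key A), τ ≠ [] ∧ (∀ t ∈ τ, t ∈ K) ∧
    ∃ u v : List A, (Config.empty A).actSeq τ = ⟨u, v⟩ ∧ w = u ++ v}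

/-- An `LK` keyboard is an automatic keyboard whose keys only write letters and use the left
arrow. -/
def AutomaticKeyboard.IsLK {A : Type*} (K : AutomaticKeyboard A) : Prop :=
  ∀ t ∈ K, ∀ σ ∈ t, σ ≠ Atom.backspace ∧ σ ≠ Atom.right

open Classical in
/-- The automatic keyboard presented by a finite list of keys. -/
noncomputable def ofList {A : Type*} (l : List (Key A)) : AutomaticKeyboard A := l.toFinset

theorem mem_ofList {A : Type*} (l : List (Key A)) (t : Key A) : t ∈ ofList l ↔ t ∈ l := by
  simp [ofList]

/-- `LK` keyboards as inputs of an algorithm: each is given by a finite list of its keys. -/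
abbrev LKInput (A : Type*) := {l : List (Key A) // (ofList l).IsLK}

/-- The keyboard which an input presents. -/
noncomputable def LKInput.keyboard {A : Type*} (K : LKInput A) : AutomaticKeyboard A :=
  ofList K.1

/-! The encoding of inputs as natural numbers: atoms are encoded as `A ⊕ Fin 3`, keys and lists of
keys by the encoding of lists. -/

/-- Atoms are letters together with three special symbols. -/
def Atom.equiv (A : Type*) : Atom A ≃ A ⊕ Fin 3 where
  toFun
    | .letter a => .inl a
    | .backspace => .inr 0
    | .left => .inr 1
    | .right => .inr 2
  invFun
    | .inl a => .letter a
    | .inr 0 => .backspace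
    | .inr 1 => .left
    | .inr 2 => .right
  left_inv x := by cases x <;> rfl
  right_inv x := by
    rcases x with a | i
    · rfl
    · fin_cases i <;> rfl

instance Atom.primcodable (A : Type*) [Primcodable A] : Primcodable (Atom A) :=
  Primcodable.ofEquiv (A ⊕ Fin 3) (Atom.equiv A)

theorem primrecPred_isLK (A : Type*) [Primcodable A] :
    PrimrecPred fun l : List (Key A) => (ofList l).IsLK := by
  have h (s : Atom A) : PrimrecPred fun σ : Atom A => σ = s :=
    Primrec.eq.comp Primrec.id (Primrec.const s)
  have h₂ : PrimrecPred fun σ : Atom A => σ ≠ Atom.backspace ∧ σ ≠ Atom.right :=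
    (h _).not.and (h _).not
  exact h₂.forall_mem_list.forall_mem_list.of_eq fun l => by
    simp only [AutomaticKeyboard.IsLK, mem_ofList]

open Classical in
noncomputable instance LKInput.primcodable (A : Type*) [Primcodable A] : Primcodable (LKInput A) :=
  Primcodable.subtype (primrecPred_isLK A)

end Keyboard

/-! The halting problem of a fixed Turing machine is reduced to emptiness of intersection.

A key which writes `x`, then the mirror image of `y`, and then moves the cursor back over the latter
takes `⟨u|v⟩` to `⟨ux|y^R v⟩`. The keyboard of a list of pairs `(x_i, y_i)` therefore has as its
language the words `x_{i_1} ... x_{i_n} (y_{i_1} ... y_{i_n})^R` with `1 ≤ n`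
(`Keyboard.mem_language_pairInput`), and the keyboard of the pairs `(a, a)` with `a` a letter has as
its language the nonempty even palindromes. If all words are coded by blocks of one length which
begin with one letter and end with another, then no nonempty word of blocks is a palindrome, so the
word above is an even palindrome only if the two concatenations agree. Hence the two languages meet
if and only if the Post correspondence problem of the pairs is solvable
(`Keyboard.IsBlockCode.inf_language_eq_bot_iff`).

Derivability in a semi-Thue system is a correspondence problem in the classical way, where the
second components are ahead of the first ones by the current word
(`Keyboard.hasMatch_iff_reflTransGen`). The words of a derivation are written alternately in two
colours, and the two components of every pair other than the start and end pairs have distinct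
colours. This forces a match to begin with the start pair and prevents the first components from
getting ahead.

A semi-Thue system simulates a Turing machine in the usual manner
(`Keyboard.reflTransGen_haltWord_iff`). Mathlib compiles a partial recursive function with
undecidable domain to a machine with finitely many states
(`Keyboard.exists_machine_not_computablePred`); so rules and target are fixed, and only the start
pair, hence a single key, depends on the input of the machine. -/

namespace Keyboard

/-! ### Keyboards of pairs of words -/

/-- The key which writes `x`, then the mirror image of `y`, and moves the cursor back between the
two, for `p = (x, y)`. -/
def pairKey {A : Type*} (p : List A × List A) : Key A :=
  p.1.map .letter ++ p.2.reverse.map .letter ++ p.2.map fun _ => .left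

theorem foldl_step_letter {A : Type*} (x u v : List A) :
    (x.map Atom.letter).foldl Config.step ⟨u, v⟩ = ⟨u ++ x, v⟩ := by
  induction x generalizing u with
  | nil => simp
  | cons a x ih => simp [Config.step, ih]

theorem foldl_step_left {A : Type*} (y u v : List A) :
    (y.map fun _ => Atom.left).foldl Config.step ⟨u ++ y.reverse, v⟩ = ⟨u, y.reverse ++ v⟩ := by
  induction y generalizing v with
  | nil => simp
  | cons a y ih =>
    have h : Config.step ⟨u ++ (a :: y).reverse, v⟩ .left = ⟨u ++ y.reverse, a :: v⟩ := by
      simp [Config.step, ← List.append_assoc]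
    rw [List.map_cons, List.foldl_cons, h, ih]
    simp

theorem act_pairKey {A : Type*} (p : List A × List A) (u v : List A) :
    Config.act ⟨u, v⟩ (pairKey p) = ⟨u ++ p.1, p.2.reverse ++ v⟩ := by
  simp only [Config.act, pairKey, List.foldl_append, foldl_step_letter, foldl_step_left]

theorem actSeq_map_pairKey {A : Type*} (s : List (List A × List A)) (u v : List A) :
    Config.actSeq ⟨u, v⟩ (s.map pairKey) =
      ⟨u ++ s.flatMap Prod.fst, (s.flatMap Prod.snd).reverse ++ v⟩ := by
  induction s generalizing u v with
  | nil => simp [Config.actSeq]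
  | cons p s ih =>
    change Config.actSeq (Config.act ⟨u, v⟩ (pairKey p)) (s.map pairKey) = _
    rw [act_pairKey, ih]
    simp

theorem isLK_map_pairKey {A : Type*} (P : List (List A × List A)) :
    (ofList (P.map pairKey)).IsLK := by
  intro t ht σ hσ
  rw [mem_ofList, List.mem_map] at ht
  obtain ⟨p, -, rfl⟩ := ht
  simp only [pairKey, List.mem_append, List.mem_map] at hσ
  rcases hσ with (⟨a, -, rfl⟩ | ⟨a, -, rfl⟩) | ⟨a, -, rfl⟩ <;> simp

/-- The input presenting the keyboard with the keys `pairKey p` for `p` in the list `P`. -/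
def pairInput {A : Type*} (P : List (List A × List A)) : LKInput A :=
  ⟨P.map pairKey, isLK_map_pairKey P⟩

theorem exists_map_eq_of_forall_mem_map {α β : Type*} {f : α → β} {P : List α} {τ : List β}
    (h : ∀ t ∈ τ, t ∈ P.map f) : ∃ s : List α, (∀ p ∈ s, p ∈ P) ∧ s.map f = τ := by
  induction τ with
  | nil => exact ⟨[], by simp, rfl⟩
  | cons t τ ih =>
    obtain ⟨s, hs, rfl⟩ := ih fun t ht => h t (List.mem_cons_of_mem _ ht)
    obtain ⟨p, hp, rfl⟩ := List.mem_map.1 (h t List.mem_cons_self)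
    exact ⟨p :: s, List.forall_mem_cons.2 ⟨hp, hs⟩, rfl⟩

theorem mem_language_pairInput {A : Type*} (P : List (List A × List A)) (w : List A) :
    w ∈ (pairInput P).keyboard.language ↔ ∃ s : List (List A × List A), s ≠ [] ∧
      (∀ p ∈ s, p ∈ P) ∧ w = s.flatMap Prod.fst ++ (s.flatMap Prod.snd).reverse := by
  constructor
  · rintro ⟨τ, hτ, hP, u, v, huv, rfl⟩
    obtain ⟨s, hs, rfl⟩ := exists_map_eq_of_forall_mem_map fun t ht => (mem_ofList _ t).1 (hP t ht)
    rw [Config.empty, actSeq_map_pairKey] at huv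
    obtain ⟨rfl, rfl⟩ := Config.mk.inj huv
    exact ⟨s, by simpa using hτ, hs, by simp⟩
  · rintro ⟨s, hs, hP, rfl⟩
    refine ⟨s.map pairKey, by simpa using hs, ?_, _, _, actSeq_map_pairKey s [] [], by simp⟩
    intro t ht
    obtain ⟨p, hp, rfl⟩ := List.mem_map.1 ht
    rw [LKInput.keyboard, mem_ofList]
    exact List.mem_map_of_mem (hP p hp)

/-- The pairs `(a, a)` of equal one-letter words; the words of the corresponding keyboard are the
nonempty even palindromes. -/
noncomputable def diagonalPairs (A : Type*) [Finite A] : List (List A × List A) :=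
  (Set.finite_univ (α := A)).toFinset.toList.map fun a => ([a], [a])

theorem mem_language_diagonalPairs {A : Type*} [Finite A] (w : List A) :
    w ∈ (pairInput (diagonalPairs A)).keyboard.language ↔ ∃ x : List A, x ≠ [] ∧
      w = x ++ x.reverse := by
  rw [mem_language_pairInput]
  constructor
  · rintro ⟨s, hs, hP, rfl⟩
    obtain ⟨x, -, rfl⟩ := exists_map_eq_of_forall_mem_map hP
    exact ⟨x, by simpa using hs, by simp [List.flatMap_map]⟩
  · rintro ⟨x, hx, rfl⟩
    refine ⟨x.map fun a => ([a], [a]), by simpa using hx, ?_,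
      by simp [List.flatMap_map]⟩
    intro p hp
    obtain ⟨a, -, rfl⟩ := List.mem_map.1 hp
    simp [diagonalPairs]

/-! ### Block codes and palindromes -/

/-- A code `φ` by blocks of one length, all of which begin with `a` and end with `b`, where
`a ≠ b`. -/
structure IsBlockCode {S A : Type*} (φ : S → List A) (a b : A) (k : ℕ) : Prop where
  injective : Function.Injective φ
  length_eq : ∀ i, (φ i).length = k
  ne : a ≠ b
  head?_eq : ∀ i, (φ i).head? = some a
  getLast?_eq : ∀ i, (φ i).getLast? = some b

theorem exists_isBlockCode (S A : Type*) [Finite S] [Nontrivial A] :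
    ∃ (φ : S → List A) (a b : A) (k : ℕ), IsBlockCode φ a b k := by
  classical
  obtain ⟨a, b, hab⟩ := exists_pair_ne A
  have := Fintype.ofFinite S
  -- The block of `i` marks the position of `i` in a list of all of `S`.
  let e : List S := Finset.univ.toList
  refine ⟨fun i => a :: (e.map (fun j => if j = i then b else a) ++ [b]), a, b,
    (Finset.univ (α := S)).card + 2, ?_, ?_, hab, ?_, ?_⟩
  · intro i j h
    simp only [List.cons.injEq, true_and, List.append_cancel_right_eq] at h
    have := List.map_inj_left.1 h i (by simp [e])
    by_contra hij
    simp [hij, hab.symm] at this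
  · intro i
    simp [e]
  · simp
  · intro i
    simp [List.getLast?_cons]

namespace IsBlockCode

variable {S A : Type*} {φ : S → List A} {a b : A} {k : ℕ}

theorem pos (h : IsBlockCode φ a b k) (i : S) : 0 < k := by
  rw [← h.length_eq i, List.length_pos_iff]
  intro hi
  simpa [hi] using h.head?_eq i

theorem length_flatMap (h : IsBlockCode φ a b k) (x : List S) :
    (x.flatMap φ).length = x.length * k := by
  simp [List.length_flatMap, h.length_eq]

theorem flatMap_injective (h : IsBlockCode φ a b k) :
    Function.Injective fun x : List S => x.flatMap φ := by
  intro x y hxy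
  induction x generalizing y with
  | nil =>
    rcases y with _ | ⟨j, y⟩
    · rfl
    · have := congrArg List.length hxy
      simp only [List.flatMap_nil, List.flatMap_cons, List.length_nil, List.length_append,
        h.length_eq] at this
      have := h.pos j
      omega
  | cons i x ih =>
    rcases y with _ | ⟨j, y⟩
    · have := congrArg List.length hxy
      simp only [List.flatMap_nil, List.flatMap_cons, List.length_nil, List.length_append,
        h.length_eq] at this
      have := h.pos i
      omega
    · simp only [List.flatMap_cons] at hxy
      obtain ⟨h₁, h₂⟩ := List.append_inj hxy (by rw [h.length_eq, h.length_eq])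
      rw [h.injective h₁, ih h₂]

/-- A nonempty concatenation of blocks begins and ends with distinct letters. -/
theorem eq_nil_of_reverse_eq (h : IsBlockCode φ a b k) (x : List S)
    (hx : (x.flatMap φ).reverse = x.flatMap φ) : x = [] := by
  rcases List.eq_nil_or_concat x with rfl | ⟨y, j, rfl⟩
  · rfl
  · have h₁ : ((y ++ [j]).flatMap φ).getLast? = some b := by
      simp [List.getLast?_append, h.getLast?_eq]
    have h₂ : ((y ++ [j]).flatMap φ).head? = some a := by
      rcases y with _ | ⟨i, y⟩ <;> simp [List.head?_append, h.head?_eq]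
    rw [List.concat_eq_append] at hx
    rw [← List.head?_reverse, hx, h₂] at h₁
    exact absurd (Option.some.inj h₁) h.ne

/-- If the code of `x` is at least half of the palindrome, it is the code of `y` followed by an even
palindrome, which is a word of blocks and so is empty. -/
theorem eq_of_length_le (h : IsBlockCode φ a b k) {x y : List S} {w : List A}
    (hw : x.flatMap φ ++ (y.flatMap φ).reverse = w ++ w.reverse)
    (hl : w.length ≤ (x.flatMap φ).length) : x = y := by
  obtain ⟨z, hz⟩ : ∃ z, x.flatMap φ = w ++ z := by
    rcases List.append_eq_append_iff.1 hw with ⟨z, h₁, h₂⟩ | ⟨z, h₁, -⟩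
    · have : z = [] := by
        rw [← List.length_eq_zero_iff]
        have := congrArg List.length h₁
        rw [List.length_append] at this
        omega
      exact ⟨[], by simp [h₁, this]⟩
    · exact ⟨z, h₁⟩
  have hw' : w = y.flatMap φ ++ z.reverse := by
    rw [hz, List.append_assoc, List.append_cancel_left_eq] at hw
    simpa using (congrArg List.reverse hw).symm
  rw [hw', List.append_assoc] at hz
  have hle : y.length ≤ x.length := by
    rcases x with _ | ⟨i, x⟩
    · have := congrArg List.length hz
      rw [List.length_append, h.length_flatMap, h.length_flatMap] at this
      rcases y with _ | ⟨j, y⟩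
      · simp
      · have := h.pos j
        simp only [List.length_cons, List.length_nil] at *
        nlinarith
    · refine Nat.le_of_mul_le_mul_right ?_ (h.pos i)
      rw [← h.length_flatMap, ← h.length_flatMap, hz, List.length_append]
      omega
  rw [← List.take_append_drop y.length x, List.flatMap_append] at hz
  obtain ⟨h₁, h₂⟩ := List.append_inj hz (by
    rw [h.length_flatMap, h.length_flatMap, List.length_take, min_eq_left hle])
  have h₃ := h.eq_nil_of_reverse_eq _ (by rw [h₂]; simp)
  rw [← List.take_append_drop y.length x, h₃, List.append_nil, h.flatMap_injective h₁]

theorem eq_of_append_reverse_eq (h : IsBlockCode φ a b k) {x y : List S} {w : List A}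
    (hw : x.flatMap φ ++ (y.flatMap φ).reverse = w ++ w.reverse) : x = y := by
  by_cases hl : w.length ≤ (x.flatMap φ).length
  · exact h.eq_of_length_le hw hl
  · refine (h.eq_of_length_le (w := w) ?_ ?_).symm
    · simpa using congrArg List.reverse hw
    · have := congrArg List.length hw
      simp only [List.length_append, List.length_reverse] at this
      omega

end IsBlockCode

/-! ### Post correspondence problems as intersections of languages of keyboards -/

/-- An instance `D` of the Post correspondence problem is solvable if some sequence of its pairs
has equal and nonempty concatenations of first and of second components. -/
def HasMatch {S : Type*} (D : Set (List S × List S)) : Prop :=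
  ∃ s : List (List S × List S), (∀ p ∈ s, p ∈ D) ∧ s.flatMap Prod.fst = s.flatMap Prod.snd ∧
    s.flatMap Prod.fst ≠ []

/-- The pair of the codes of the components of a pair of words. -/
def encodePair {S A : Type*} (φ : S → List A) (p : List S × List S) : List A × List A :=
  (p.1.flatMap φ, p.2.flatMap φ)

theorem IsBlockCode.inf_language_eq_bot_iff {S A : Type*} [Finite A] {φ : S → List A} {a b : A}
    {k : ℕ} (h : IsBlockCode φ a b k) (D : List (List S × List S)) :
    (pairInput (D.map (encodePair φ))).keyboard.language ⊓
      (pairInput (diagonalPairs A)).keyboard.language = ⊥ ↔ ¬ HasMatch {p | p ∈ D} := by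
  have hfst (s : List (List S × List S)) :
      (s.map (encodePair φ)).flatMap Prod.fst = (s.flatMap Prod.fst).flatMap φ := by
    simp [List.flatMap_map, List.flatMap_assoc, encodePair]
  have hsnd (s : List (List S × List S)) :
      (s.map (encodePair φ)).flatMap Prod.snd = (s.flatMap Prod.snd).flatMap φ := by
    simp [List.flatMap_map, List.flatMap_assoc, encodePair]
  rw [← not_iff_not, not_not, ← ne_eq]
  refine Set.nonempty_iff_ne_empty.symm.trans ⟨?_, ?_⟩
  · rintro ⟨w, h₁, h₂⟩
    obtain ⟨s, hs, hD, rfl⟩ := (mem_language_pairInput _ _).1 h₁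
    obtain ⟨x, hx, hw⟩ := (mem_language_diagonalPairs _).1 h₂
    obtain ⟨s, hD', rfl⟩ := exists_map_eq_of_forall_mem_map hD
    rw [hfst, hsnd] at hw
    have heq := h.eq_of_append_reverse_eq hw
    refine ⟨s, hD', heq, fun h0 => hx ?_⟩
    rw [← heq, h0] at hw
    simpa using hw.symm
  · rintro ⟨s, hD, heq, hne⟩
    refine ⟨(s.flatMap Prod.fst).flatMap φ ++ ((s.flatMap Prod.fst).flatMap φ).reverse,
      (mem_language_pairInput _ _).2 ⟨s.map (encodePair φ), ?_, ?_, ?_⟩,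
      (mem_language_diagonalPairs _).2 ⟨_, ?_, rfl⟩⟩
    · rintro h0
      rw [List.map_eq_nil_iff] at h0
      simp [h0] at hne
    · intro p hp
      obtain ⟨p, hp', rfl⟩ := List.mem_map.1 hp
      exact List.mem_map_of_mem (hD p hp')
    · rw [hfst, hsnd, heq]
    · exact fun h0 => hne (h.flatMap_injective h0)

/-! ### Semi-Thue systems and the Post correspondence problem -/

open Relation

/-- One step of the semi-Thue system with the set `R` of rules: a factor which is the left side of
a rule is replaced by the right side. -/
def Rewrites {S : Type*} (R : Set (List S × List S)) (x y : List S) : Prop :=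
  ∃ p q l r, (l, r) ∈ R ∧ x = p ++ l ++ q ∧ y = p ++ r ++ q

/-- The letters of the correspondence problem of a semi-Thue system over `S`: the letters of `S` in
two colours, a start marker and an end marker. -/
abbrev TileLetter (S : Type*) := (S × Bool) ⊕ Bool

/-- The start marker. -/
abbrev startMarker {S : Type*} : TileLetter S := .inr true

/-- The end marker. -/
abbrev endMarker {S : Type*} : TileLetter S := .inr false

/-- The word `w` in the colour `c`. -/
def colour {S : Type*} (c : Bool) (w : List S) : List (TileLetter S) :=
  w.map fun a => .inl (a, c)

/-- The pairs, apart from the start pair, of the correspondence problem of a semi-Thue system: they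
copy a letter or apply a rule and change the colour, or close a match after the target `t`. -/
inductive Tile {S : Type*} (R : Set (List S × List S)) (t : List S) :
    List (TileLetter S) × List (TileLetter S) → Prop
  | copy (c : Bool) (a : S) : Tile R t (colour c [a], colour (!c) [a])
  | rule (c : Bool) {l r : List S} (h : (l, r) ∈ R) : Tile R t (colour c l, colour (!c) r)
  | last (c : Bool) : Tile R t (colour c t ++ [endMarker], [endMarker])

/-- The start pair, which provides the initial word `w`. -/
def startTile {S : Type*} (w : List S) : List (TileLetter S) × List (TileLetter S) :=
  ([startMarker], startMarker :: colour true w)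

section

variable {S : Type*} {R : Set (List S × List S)} {t w : List S}

theorem colour_append (c : Bool) (x y : List S) : colour c (x ++ y) = colour c x ++ colour c y :=
  List.map_append

theorem colour_injective (c : Bool) : Function.Injective (colour (S := S) c) :=
  List.map_injective_iff.2 fun a b h => by simpa using h

theorem endMarker_notMem_colour (c : Bool) (x : List S) : endMarker ∉ colour c x := by
  simp [colour]

theorem eq_of_mem_colour {c d : Bool} {x : List S} {a : S} (h : .inl (a, d) ∈ colour c x) :
    d = c := by
  simp only [colour, List.mem_map, Sum.inl.injEq, Prod.mk.injEq] at h
  obtain ⟨_, -, -, h⟩ := h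
  exact h.symm

theorem eq_of_append_cons_eq {α : Type*} {x y u v : List α} {a : α} (hx : a ∉ x) (hy : a ∉ y)
    (h : x ++ a :: u = y ++ a :: v) : x = y := by
  classical
  have := congrArg (List.takeWhile (· ≠ a)) h
  have key {x : List α} (hx : a ∉ x) (u : List α) : (x ++ a :: u).takeWhile (· ≠ a) = x := by
    rw [List.takeWhile_append_of_pos]
    · simp
    · intro b hb
      simpa using fun h : b = a => hx (h ▸ hb)
  rwa [key hx, key hy] at this

/-- A partial match in which the second components are ahead by the rest `x` of the current word, in
one colour, and the beginning `y` of the next word, in the other colour, can only be completed if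
`y ++ x` rewrites to the target. As the two components of a pair begin with letters of distinct
colours, the first components never get ahead. -/
theorem reflTransGen_of_tiles (hR : ∀ l r, (l, r) ∈ R → l ≠ [] ∧ r ≠ [])
    (s : List (List (TileLetter S) × List (TileLetter S)))
    (hs : ∀ p ∈ s, p = startTile w ∨ Tile R t p) (c : Bool) (x y : List S) (hxy : y ++ x ≠ [])
    (h : s.flatMap Prod.fst = colour c x ++ colour (!c) y ++ s.flatMap Prod.snd) :
    ReflTransGen (Rewrites R) (y ++ x) t := by
  induction s generalizing c x y with
  | nil =>
    simp only [List.flatMap_nil, List.append_nil, List.nil_eq, List.append_eq_nil_iff, colour,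
      List.map_eq_nil_iff] at h
    exact absurd (by simp [h]) hxy
  | cons d s ih =>
    -- If `x` is exhausted, then `y` becomes the current word.
    wlog hx : x ≠ [] generalizing c x y
    · rw [not_not] at hx
      subst hx
      have := this (!c) y [] (by simpa using hxy) (by simpa [colour] using h) (by simpa using hxy)
      simpa using this
    obtain ⟨a, x', rfl⟩ := List.exists_cons_of_ne_nil hx
    replace ih := ih fun p hp => hs p (List.mem_cons_of_mem _ hp)
    have step (c' : Bool) (l r : List S) (hl : l ≠ []) (hr : r ≠ [])
        (hd : d = (colour c' l, colour (!c') r))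
        (hlr : ∀ p q, ReflTransGen (Rewrites R) (p ++ l ++ q) (p ++ r ++ q)) :
        ReflTransGen (Rewrites R) (y ++ a :: x') t := by
      subst hd
      obtain ⟨b, l', rfl⟩ := List.exists_cons_of_ne_nil hl
      obtain ⟨rfl, rfl⟩ : b = a ∧ c' = c := by
        simp only [List.flatMap_cons, colour, List.map_cons, List.cons_append, List.cons.injEq,
          Sum.inl.injEq, Prod.mk.injEq] at h
        exact h.1
      generalize b :: x' = x at *
      generalize b :: l' = l at *
      simp only [List.flatMap_cons, List.append_assoc] at h
      have key (z : List S) (hz : x = l ++ z) (h' : s.flatMap Prod.fst =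
          colour c' z ++ (colour (!c') y ++ (colour (!c') r ++ s.flatMap Prod.snd))) :
          ReflTransGen (Rewrites R) (y ++ x) t := by
        have := ih c' z (y ++ r) (by simp [hr]) (by simpa [colour_append] using h')
        subst hz
        rw [← List.append_assoc]
        exact (hlr y z).trans this
      rcases List.append_eq_append_iff.1 h with ⟨z, h₁, h₂⟩ | ⟨z, h₁, h₂⟩
      · obtain ⟨l₁, z₁, rfl, h₃, rfl⟩ := List.map_eq_append_iff.1 h₁
        exact key z₁ (by rw [colour_injective c' h₃]) h₂
      · rcases z with _ | ⟨e, z⟩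
        · exact key [] (by simpa using (colour_injective c' (by simpa using h₁)).symm)
            (by simpa [colour] using h₂.symm)
        · -- The letter `e` would have both colours.
          have he : e ∈ colour c' l := by rw [h₁]; simp
          have he' : e ∈ colour (!c') (y ++ r) := by
            have : colour (!c') (y ++ r) ≠ [] := by simp [colour, hr]
            obtain ⟨f, v, hv⟩ := List.exists_cons_of_ne_nil this
            rw [← List.append_assoc, ← colour_append, hv] at h₂
            rw [hv, (List.cons.inj h₂).1]
            exact List.mem_cons_self
          obtain ⟨f, -, rfl⟩ := List.mem_map.1 he
          exact absurd (eq_of_mem_colour he') (by simp)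
    rcases hs d List.mem_cons_self with hd | hd
    · subst hd
      simp [startTile, colour] at h
    · cases hd with
      | copy c' b => exact step c' [b] [b] (by simp) (by simp) rfl fun p q => .refl
      | rule c' hlr =>
        exact step c' _ _ (hR _ _ hlr).1 (hR _ _ hlr).2 rfl fun p q =>
          .single ⟨p, q, _, _, hlr, rfl, rfl⟩
      | last c' =>
        simp only [List.flatMap_cons, List.append_assoc, List.cons_append, List.nil_append] at h
        have h₁ := eq_of_append_cons_eq (endMarker_notMem_colour _ _) (by simp [colour])
          (h.trans (List.append_assoc _ _ _).symm)
        have hc : c = c' := eq_of_mem_colour (x := t) (a := a) (by rw [h₁]; simp [colour])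
        have hy : y = [] := by
          by_contra hy
          obtain ⟨b, y', rfl⟩ := List.exists_cons_of_ne_nil hy
          have := eq_of_mem_colour (c := c') (x := t) (a := b) (d := !c)
            (by rw [h₁]; simp [colour])
          simp [hc] at this
        subst hc hy
        rw [colour_injective c (h₁.trans (List.append_nil _))]
        exact .refl

/-- Provided that rules and target have no empty words, the target can be derived from `w` if and
only if the associated correspondence problem is solvable. -/
theorem hasMatch_iff_reflTransGen (hR : ∀ l r, (l, r) ∈ R → l ≠ [] ∧ r ≠ []) (ht : t ≠ [])
    (hw : w ≠ []) :
    HasMatch {p | p = startTile w ∨ Tile R t p} ↔ ReflTransGen (Rewrites R) w t := by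
  constructor
  · rintro ⟨s, hs, h, hne⟩
    rcases s with _ | ⟨d, s⟩
    · simp at hne
    -- Only the start pair has components with the same first letter.
    rcases hs d List.mem_cons_self with rfl | hd
    · simp only [startTile, List.flatMap_cons, List.cons_append, List.nil_append,
        List.cons.injEq, true_and] at h
      have := reflTransGen_of_tiles hR s (fun p hp => hs p (List.mem_cons_of_mem _ hp)) true w []
        (by simpa using hw) (by simpa [colour] using h)
      simpa using this
    · exfalso
      cases hd with
      | copy c a => simp [colour] at h
      | @rule c l r hlr =>
        obtain ⟨a, l, rfl⟩ := List.exists_cons_of_ne_nil (hR _ _ hlr).1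
        obtain ⟨b, r, rfl⟩ := List.exists_cons_of_ne_nil (hR _ _ hlr).2
        simp [colour] at h
      | last c =>
        obtain ⟨a, l, rfl⟩ := List.exists_cons_of_ne_nil ht
        simp [colour] at h
  · intro h
    have copies (c : Bool) (x : List S) : ∃ s : List (List (TileLetter S) × List (TileLetter S)),
        (∀ p ∈ s, Tile R t p) ∧ s.flatMap Prod.fst = colour c x ∧
          s.flatMap Prod.snd = colour (!c) x := by
      refine ⟨x.map fun a => (colour c [a], colour (!c) [a]), ?_, ?_, ?_⟩
      · intro p hp
        obtain ⟨a, -, rfl⟩ := List.mem_map.1 hp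
        exact .copy c a
      all_goals rw [List.flatMap_map, colour, List.map_eq_flatMap]; rfl
    clear hw
    -- Every rewriting step is one pass over the word, which changes its colour.
    have main (c : Bool) : ∃ s : List (List (TileLetter S) × List (TileLetter S)),
        (∀ p ∈ s, Tile R t p) ∧ s.flatMap Prod.fst = colour c w ++ s.flatMap Prod.snd := by
      induction h using ReflTransGen.head_induction_on generalizing c with
      | refl => exact ⟨[_], by simpa using .last c, by simp⟩
      | @head x y hxy _ ih =>
        obtain ⟨p, q, l, r, hlr, rfl, rfl⟩ := hxy
        obtain ⟨s, hs, h⟩ := ih (!c)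
        obtain ⟨s₁, hs₁, h₁, h₁'⟩ := copies c p
        obtain ⟨s₂, hs₂, h₂, h₂'⟩ := copies c q
        refine ⟨s₁ ++ (colour c l, colour (!c) r) :: (s₂ ++ s), ?_, ?_⟩
        · intro d hd
          rw [List.mem_append, List.mem_cons, List.mem_append] at hd
          rcases hd with hd | rfl | hd | hd
          exacts [hs₁ d hd, .rule c hlr, hs₂ d hd, hs d hd]
        · simp [h₁, h₂, h₁', h₂', h, colour_append]
    obtain ⟨s, hs, h⟩ := main true
    refine ⟨startTile w :: s, List.forall_mem_cons.2 ⟨.inl rfl, fun p hp => .inr (hs p hp)⟩, ?_, ?_⟩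
    · simp [startTile, h]
    · simp [startTile]

end

/-! ### Turing machines and semi-Thue systems -/

open Relation Turing

/-- The letters of words which describe configurations of a Turing machine: tape symbols, states,
the two ends of the tape, and a mark which records that the machine has halted. -/
inductive TapeLetter (Γ Q : Type*)
  | symbol (a : Γ)
  | state (q : Q)
  | leftEnd
  | rightEnd
  | halted

instance {Γ Q : Type*} [Finite Γ] [Finite Q] : Finite (TapeLetter Γ Q) := by
  let f : TapeLetter Γ Q → Γ ⊕ Q ⊕ Fin 3
    | .symbol a => .inl a
    | .state q => .inr (.inl q)
    | .leftEnd => .inr (.inr 0)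
    | .rightEnd => .inr (.inr 1)
    | .halted => .inr (.inr 2)
  refine Finite.of_injective f fun x y h => ?_
  cases x <;> cases y <;> simp_all [f]

section

variable {Γ Λ : Type*} {S : Set Λ}

open TapeLetter

/-- The description of the configuration with state `q`, with the tape contents `l` to the left of
the head, read from the head, and `r` under and to the right of the head. -/
def configWord (l : List Γ) (q : S) (r : List Γ) : List (TapeLetter Γ S) :=
  leftEnd :: l.reverse.map symbol ++ state q :: (r.map symbol ++ [rightEnd])

/-- The word describing a halted configuration after erasure of the tape. -/
def haltWord : List (TapeLetter Γ S) := [leftEnd, halted, rightEnd]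

/-- The only state in the description of a configuration is that of the configuration. -/
theorem configWord_eq_append_state {l r : List Γ} {q q' : S} {u v : List (TapeLetter Γ S)}
    (h : configWord l q r = u ++ state q' :: v) :
    leftEnd :: l.reverse.map symbol = u ∧ q = q' ∧ r.map symbol ++ [rightEnd] = v := by
  rw [configWord, List.append_cons_inj_of_notMem (by simp) (by simp)] at h
  simpa using h

theorem halted_notMem_configWord (l : List Γ) (q : S) (r : List Γ) :
    halted ∉ configWord l q r := by
  simp [configWord]

theorem exists_of_map_symbol_append_eq {r : List Γ} {a : Γ} {v : List (TapeLetter Γ S)}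
    (h : r.map symbol ++ [rightEnd] = symbol a :: v) :
    ∃ r', r = a :: r' ∧ v = r'.map symbol ++ [rightEnd] := by
  rcases r with _ | ⟨b, r⟩
  · simp at h
  · simp only [List.map_cons, List.cons_append, List.cons.injEq, symbol.injEq] at h
    exact ⟨r, by rw [h.1], h.2.symm⟩

variable [Inhabited Γ] [Inhabited Λ]

/-- The rules by which a semi-Thue system simulates a Turing machine with states in `S`: the moves
of the machine, extension of the tape by a blank at either end, and, once the machine halts, the
erasure of the tape. -/
inductive MachineRule (M : TM0.Machine Γ Λ) (S : Set Λ) :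
    List (TapeLetter Γ S) → List (TapeLetter Γ S) → Prop
  | write {q q' : S} {a b : Γ} (h : M q a = some (q'.1, .write b)) :
    MachineRule M S [state q, symbol a] [state q', symbol b]
  | moveRight {q q' : S} {a : Γ} (h : M q a = some (q'.1, .move .right)) :
    MachineRule M S [state q, symbol a] [symbol a, state q']
  | moveLeft {q q' : S} {a : Γ} (b : Γ) (h : M q a = some (q'.1, .move .left)) :
    MachineRule M S [symbol b, state q, symbol a] [state q', symbol b, symbol a]
  | halt {q : S} {a : Γ} (h : M q a = none) : MachineRule M S [state q, symbol a] [halted]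
  | extendRight (q : S) : MachineRule M S [state q, rightEnd] [state q, symbol default, rightEnd]
  | extendLeft (q : S) : MachineRule M S [leftEnd, state q] [leftEnd, symbol default, state q]
  | eraseRight (a : Γ) : MachineRule M S [halted, symbol a] [halted]
  | eraseLeft (a : Γ) : MachineRule M S [symbol a, halted] [halted]

/-- The set of rules which simulate the machine `M`. -/
def machineRules (M : TM0.Machine Γ Λ) (S : Set Λ) :
    Set (List (TapeLetter Γ S) × List (TapeLetter Γ S)) :=
  {p | MachineRule M S p.1 p.2}

variable {M : TM0.Machine Γ Λ}

theorem finite_machineRules [Finite Γ] (hS : S.Finite) : (machineRules M S).Finite := by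
  have := hS.to_subtype
  refine ((List.finite_length_le (TapeLetter Γ S) 3).prod
    (List.finite_length_le (TapeLetter Γ S) 3)).subset ?_
  rintro ⟨l, r⟩ h
  cases (show MachineRule M S l r from h) <;> simp

theorem ne_nil_of_mem_machineRules (l r : List (TapeLetter Γ S)) (h : (l, r) ∈ machineRules M S) :
    l ≠ [] ∧ r ≠ [] := by
  cases (show MachineRule M S l r from h) <;> simp

/-- The configuration which `configWord l q r` describes. -/
def tapeConfig (l : List Γ) (q : S) (r : List Γ) : TM0.Cfg Γ Λ :=
  ⟨q, Tape.mk' (ListBlank.mk l) (ListBlank.mk r)⟩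

theorem step_tapeConfig (l : List Γ) (q : S) (a : Γ) (r : List Γ) :
    TM0.step M (tapeConfig l q (a :: r)) = (M q a).map fun p => ⟨p.1, match p.2 with
      | .move d => (Tape.mk' (ListBlank.mk l) (ListBlank.mk (a :: r))).move d
      | .write b => (Tape.mk' (ListBlank.mk l) (ListBlank.mk (a :: r))).write b⟩ := by
  rfl

theorem mk_singleton_default : ListBlank.mk [(default : Γ)] = ListBlank.mk [] := by
  exact (Quotient.sound' (Or.inl ⟨1, rfl⟩)).symm

/-- Rewriting the description of a configuration extends the tape by a blank, performs a step of
the machine, or records that the machine has halted. -/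
theorem of_rewrites_configWord {l r : List Γ} {q : S} {w : List (TapeLetter Γ S)}
    (h : Rewrites (machineRules M S) (configWord l q r) w) :
    TM0.step M (tapeConfig l q r) = none ∨ ∃ l' q' r', w = configWord l' q' r' ∧
      (tapeConfig l' q' r' = tapeConfig l q r ∨
        TM0.step M (tapeConfig l q r) = some (tapeConfig l' q' r')) := by
  obtain ⟨u, v, x, y, hxy, h, rfl⟩ := h
  cases (show MachineRule M S x y from hxy) with
  | @write q₁ q' a b hM =>
    obtain ⟨rfl, rfl, h₃⟩ := configWord_eq_append_state (u := u) (v := symbol a :: v)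
      (by simpa using h)
    obtain ⟨r, rfl, rfl⟩ := exists_of_map_symbol_append_eq h₃
    refine .inr ⟨l, q', b :: r, by simp [configWord], .inr ?_⟩
    rw [step_tapeConfig, hM]
    simp [tapeConfig, Tape.write_mk']
  | @moveRight q₁ q' a hM =>
    obtain ⟨rfl, rfl, h₃⟩ := configWord_eq_append_state (u := u) (v := symbol a :: v)
      (by simpa using h)
    obtain ⟨r, rfl, rfl⟩ := exists_of_map_symbol_append_eq h₃
    refine .inr ⟨a :: l, q', r, by simp [configWord], .inr ?_⟩
    rw [step_tapeConfig, hM]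
    simp [tapeConfig, Tape.move_right_mk']
  | @moveLeft q₁ q' a b hM =>
    obtain ⟨h₁, rfl, h₃⟩ := configWord_eq_append_state (u := u ++ [symbol b]) (v := symbol a :: v)
      (by simpa using h)
    obtain ⟨r, rfl, rfl⟩ := exists_of_map_symbol_append_eq h₃
    obtain ⟨l, rfl, rfl⟩ : ∃ l', l = b :: l' ∧ u = leftEnd :: l'.reverse.map symbol := by
      rcases l with _ | ⟨b', l⟩
      · rcases u with _ | ⟨_, u⟩ <;> simp at h₁
      · rw [List.reverse_cons, List.map_append, ← List.cons_append] at h₁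
        obtain ⟨h₁, h₂⟩ := List.append_inj' h₁ rfl
        simp only [List.map_cons, List.map_nil, List.cons.injEq, symbol.injEq, and_true] at h₂
        exact ⟨l, by rw [h₂], h₁.symm⟩
    refine .inr ⟨l, q', b :: a :: r, by simp [configWord], .inr ?_⟩
    rw [step_tapeConfig, hM]
    simp [tapeConfig, Tape.move_left_mk']
  | @halt q₁ a hM =>
    obtain ⟨rfl, rfl, h₃⟩ := configWord_eq_append_state (u := u) (v := symbol a :: v)
      (by simpa using h)
    obtain ⟨r, rfl, rfl⟩ := exists_of_map_symbol_append_eq h₃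
    rw [step_tapeConfig, hM]
    exact .inl rfl
  | extendRight q₁ =>
    obtain ⟨rfl, rfl, h₃⟩ := configWord_eq_append_state (u := u) (v := rightEnd :: v)
      (by simpa using h)
    rcases r with _ | ⟨a, r⟩
    · obtain rfl : v = [] := by simpa using h₃.symm
      exact .inr ⟨l, q, [default], by simp [configWord],
        .inl (by rw [tapeConfig, tapeConfig, mk_singleton_default])⟩
    · simp at h₃
  | extendLeft q₁ =>
    obtain ⟨h₁, rfl, rfl⟩ := configWord_eq_append_state (u := u ++ [leftEnd]) (v := v)
      (by simpa using h)
    rcases u with _ | ⟨c, u⟩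
    · obtain rfl : l = [] := by simpa using h₁
      exact .inr ⟨[default], q, r, by simp [configWord],
        .inl (by rw [tapeConfig, tapeConfig, mk_singleton_default])⟩
    · have : leftEnd ∈ l.reverse.map (symbol (Q := S)) := by
        rw [(List.cons.inj h₁).2]
        simp
      simp at this
  | eraseRight a => exact absurd (by rw [h]; simp) (halted_notMem_configWord l q r)
  | eraseLeft a => exact absurd (by rw [h]; simp) (halted_notMem_configWord l q r)

theorem MachineRule.rewrites {x y : List (TapeLetter Γ S)} (h : MachineRule M S x y)
    (u v : List (TapeLetter Γ S)) :
    Rewrites (machineRules M S) (u ++ x ++ v) (u ++ y ++ v) :=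
  ⟨u, v, x, y, h, rfl, rfl⟩

/-- Blanks may be added to the description of a configuration until there are symbols on both sides
of the head. -/
theorem exists_extension (M : TM0.Machine Γ Λ) (l : List Γ) (q : S) (r : List Γ) :
    ∃ b l' a r', tapeConfig (b :: l') q (a :: r') = tapeConfig l q r ∧
      ReflTransGen (Rewrites (machineRules M S)) (configWord l q r)
        (configWord (b :: l') q (a :: r')) := by
  have hr : ∃ a r', tapeConfig l q (a :: r') = tapeConfig l q r ∧
      ReflTransGen (Rewrites (machineRules M S)) (configWord l q r)
        (configWord l q (a :: r')) := by
    rcases r with _ | ⟨a, r⟩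
    · refine ⟨default, [], by rw [tapeConfig, tapeConfig, mk_singleton_default], .single ?_⟩
      simpa [configWord] using MachineRule.rewrites (MachineRule.extendRight (M := M) q)
        (leftEnd :: l.reverse.map symbol) []
    · exact ⟨a, r, rfl, .refl⟩
  obtain ⟨a, r', h₁, h₂⟩ := hr
  rcases l with _ | ⟨b, l⟩
  · refine ⟨default, [], a, r', ?_, h₂.tail ?_⟩
    · rw [← h₁, tapeConfig, tapeConfig, mk_singleton_default]
    · simpa [configWord] using MachineRule.rewrites (MachineRule.extendLeft (M := M) q)
        [] (symbol a :: (r'.map symbol ++ [rightEnd]))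
  · exact ⟨b, l, a, r', h₁, h₂⟩

theorem reflTransGen_haltWord (M : TM0.Machine Γ Λ) (l r : List Γ) :
    ReflTransGen (Rewrites (machineRules M S))
      (leftEnd :: l.reverse.map symbol ++ halted :: (r.map symbol ++ [rightEnd])) haltWord := by
  induction r with
  | nil =>
    induction l with
    | nil => exact .refl
    | cons b l ih =>
      refine .head ?_ ih
      simpa using MachineRule.rewrites (MachineRule.eraseLeft (M := M) (S := S) b)
        (leftEnd :: l.reverse.map symbol) [rightEnd]
  | cons a r ih =>
    refine .head ?_ ih
    simpa using MachineRule.rewrites (MachineRule.eraseRight (M := M) (S := S) a)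
      (leftEnd :: l.reverse.map symbol) (r.map symbol ++ [rightEnd])

theorem exists_reflTransGen_of_step (hS : TM0.Supports M S) {l r : List Γ} {q : S}
    {c : TM0.Cfg Γ Λ} (h : TM0.step M (tapeConfig l q r) = some c) :
    ∃ l' q' r', c = tapeConfig l' q' r' ∧
      ReflTransGen (Rewrites (machineRules M S)) (configWord l q r) (configWord l' q' r') := by
  obtain ⟨b, l', a, r', h₁, h₂⟩ := exists_extension M l q r
  rw [← h₁, step_tapeConfig, Option.map_eq_some_iff] at h
  obtain ⟨⟨q', s⟩, hM, rfl⟩ := h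
  have hq' : q' ∈ S := hS.2 hM q.2
  rcases s with (_ | _) | b'
  · refine ⟨l', ⟨q', hq'⟩, b :: a :: r', by simp [tapeConfig, Tape.move_left_mk'], h₂.tail ?_⟩
    simpa [configWord] using MachineRule.rewrites
      (MachineRule.moveLeft (q' := ⟨q', hq'⟩) b hM)
      (leftEnd :: l'.reverse.map symbol) (r'.map symbol ++ [rightEnd])
  · refine ⟨a :: b :: l', ⟨q', hq'⟩, r', by simp [tapeConfig, Tape.move_right_mk'], h₂.tail ?_⟩
    simpa [configWord] using MachineRule.rewrites
      (MachineRule.moveRight (q' := ⟨q', hq'⟩) hM)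
      (leftEnd :: (b :: l').reverse.map symbol) (r'.map symbol ++ [rightEnd])
  · refine ⟨b :: l', ⟨q', hq'⟩, b' :: r', by simp [tapeConfig, Tape.write_mk'], h₂.tail ?_⟩
    simpa [configWord] using MachineRule.rewrites
      (MachineRule.write (q' := ⟨q', hq'⟩) hM)
      (leftEnd :: (b :: l').reverse.map symbol) (r'.map symbol ++ [rightEnd])

theorem reflTransGen_of_step_eq_none {l r : List Γ} {q : S}
    (h : TM0.step M (tapeConfig l q r) = none) :
    ReflTransGen (Rewrites (machineRules M S)) (configWord l q r) haltWord := by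
  obtain ⟨b, l', a, r', h₁, h₂⟩ := exists_extension M l q r
  rw [← h₁, step_tapeConfig, Option.map_eq_none_iff] at h
  refine (h₂.tail ?_).trans (reflTransGen_haltWord M (b :: l') r')
  simpa [configWord] using MachineRule.rewrites (MachineRule.halt h)
    (leftEnd :: (b :: l').reverse.map symbol) (r'.map symbol ++ [rightEnd])

/-- The machine halts from a configuration if and only if the description of the configuration
rewrites to the word `haltWord`. -/
theorem reflTransGen_haltWord_iff (hS : TM0.Supports M S) (l : List Γ) (q : S) (r : List Γ) :
    ReflTransGen (Rewrites (machineRules M S)) (configWord l q r) haltWord ↔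
      (StateTransition.eval (TM0.step M) (tapeConfig l q r)).Dom := by
  constructor
  · intro h
    generalize hw : configWord l q r = w at h
    induction h using ReflTransGen.head_induction_on generalizing l q r with
    | refl => exact absurd (by rw [hw]; simp [haltWord]) (halted_notMem_configWord l q r)
    | head hxy _ ih =>
      subst hw
      rcases of_rewrites_configWord hxy with h | ⟨l', q', r', rfl, h | h⟩
      · exact Part.dom_iff_mem.2 ⟨_, StateTransition.mem_eval.2 ⟨.refl, h⟩⟩
      · rw [← h]
        exact ih l' q' r' rfl
      · rw [StateTransition.reaches_eval (.single h)]
        exact ih l' q' r' rfl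
  · intro h
    obtain ⟨d, hd⟩ := Part.dom_iff_mem.1 h
    obtain ⟨h₁, h₂⟩ := StateTransition.mem_eval.1 hd
    generalize hc : tapeConfig l q r = c at h₁
    clear h hd
    induction h₁ using ReflTransGen.head_induction_on generalizing l q r with
    | refl =>
      subst hc
      exact reflTransGen_of_step_eq_none h₂
    | head hxy _ ih =>
      subst hc
      obtain ⟨l', q', r', rfl, h⟩ := exists_reflTransGen_of_step hS hxy
      exact h.trans (ih l' q' r' rfl)

end

/-! ### A machine with an undecidable halting problem -/

open Turing
open Nat.Partrec (Code)

theorem trNat_two_pow (n : ℕ) :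
    PartrecToTM2.trNat (2 ^ n) =
      List.replicate n PartrecToTM2.Γ'.bit0 ++ [PartrecToTM2.Γ'.bit1] := by
  have h (m : ℕ) : ((PosNum.bit0^[m] 1 : PosNum) : ℕ) = 2 ^ m := by
    induction m with
    | zero => rfl
    | succ m ih => rw [Function.iterate_succ_apply', PosNum.cast_bit0, ih, pow_succ, mul_two]
  rw [PartrecToTM2.trNat, ← h, PosNum.of_to_nat]
  induction n with
  | zero => rfl
  | succ n ih =>
    rw [Function.iterate_succ_apply']
    exact congrArg (PartrecToTM2.Γ'.bit0 :: ·) ih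

/-- The machines below read their inputs in binary. The binary expansion of `2 ^ n`, unlike that of
`n`, is plainly computable from `n`, so `n` is presented as `2 ^ n`. -/
theorem exists_partrec_not_computablePred :
    ∃ f : ℕ →. ℕ, Nat.Partrec f ∧ ¬ ComputablePred fun n => (f (2 ^ n)).Dom := by
  let f : ℕ →. ℕ := fun m =>
    (Nat.rfind fun k => (Part.some (decide (2 ^ k = m)) : Part Bool)).bind fun k =>
      Code.eval (Denumerable.ofNat Code k) 0
  have hpow : Primrec fun k : ℕ => 2 ^ k := by
    refine (Primrec.nat_rec₁ 1 ((Primrec.nat_mul.comp (Primrec.const 2) Primrec.snd).to₂)).of_eq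
      fun k => ?_
    induction k with
    | zero => rfl
    | succ k ih =>
      simp only [pow_succ]
      simp only at ih
      rw [mul_comm, ← ih]
  refine ⟨f, Partrec.nat_iff.1 ?_, ?_⟩
  · refine Partrec.bind (Partrec.rfind ?_) ?_
    · have : PrimrecRel fun m k : ℕ => 2 ^ k = m :=
        Primrec.eq.comp₂ (hpow.comp₂ Primrec₂.right) Primrec₂.left
      exact this.decide.to_comp.partrec₂
    · exact Code.eval_part.comp ((Computable.ofNat Code).comp Computable.snd) (Computable.const 0)
  · intro h
    refine ComputablePred.halting_problem 0 ?_
    have hf (n : ℕ) : f (2 ^ n) = Code.eval (Denumerable.ofNat Code n) 0 := by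
      have : Nat.rfind (fun k => (Part.some (decide (2 ^ k = 2 ^ n)) : Part Bool)) =
          Part.some n := by
        refine Part.eq_some_iff.2 (Nat.mem_rfind.2 ⟨by simp, fun {m} hm => ?_⟩)
        simpa using hm.ne
      simp only [f, this, Part.bind_some]
    refine ComputablePred.computable_of_manyOneReducible
      ⟨Encodable.encode, Computable.encode, fun c => ?_⟩ h
    rw [hf, Denumerable.ofNat_encode]

instance : Finite PartrecToTM2.K' :=
  Finite.of_surjective (![.main, .rev, .aux, .stack] : Fin 4 → PartrecToTM2.K') fun k => by
    cases k
    exacts [⟨0, rfl⟩, ⟨1, rfl⟩, ⟨2, rfl⟩, ⟨3, rfl⟩]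

/-- There is a Turing machine, with finitely many states, whose halting problem is undecidable for
inputs of the form `x g g ... g`. -/
theorem exists_machine_not_computablePred :
    ∃ (Γ Λ : Type) (_ : Finite Γ) (_ : Inhabited Γ) (_ : Inhabited Λ) (M : TM0.Machine Γ Λ)
      (S : Set Λ) (x : List Γ) (g : Γ), S.Finite ∧ TM0.Supports M S ∧
      ¬ ComputablePred fun n => (TM0.eval M (x ++ List.replicate n g)).Dom := by
  obtain ⟨f, hf, hf'⟩ := exists_partrec_not_computablePred
  obtain ⟨c, hc⟩ := ToPartrec.Code.exists_code (Nat.Partrec'.part_iff₁.2 (Partrec.nat_iff.2 hf))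
  -- The initial state of a machine is the default one.
  let q₀ := PartrecToTM2.trNormal c .halt
  let : Inhabited PartrecToTM2.Λ' := ⟨q₀⟩
  let := Fintype.ofFinite PartrecToTM2.K'
  let M₁ := TM2to1.tr PartrecToTM2.tr
  let M₀ := TM1to0.tr M₁
  -- The four stacks are the tracks of one tape. The input occupies only the main stack, and
  -- `bottom` is the lowest cell of the stacks.
  let letter (s : PartrecToTM2.Γ') : TM2to1.Γ' PartrecToTM2.K' (fun _ => PartrecToTM2.Γ') :=
    (false, Function.update (fun _ => none) .main (some s))
  let bottom : TM2to1.Γ' PartrecToTM2.K' (fun _ => PartrecToTM2.Γ') := (true, (letter .cons).2)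
  refine ⟨_, _, inferInstance, inferInstance, inferInstance, M₀, _,
    [bottom, letter .bit1], letter .bit0, Finset.finite_toSet _,
    TM1to0.tr_supports _ (TM2to1.tr_supports _ (PartrecToTM2.tr_supports c .halt)), ?_⟩
  convert hf' using 3 with n
  have h₁ : [bottom, letter .bit1] ++ List.replicate n (letter .bit0) =
      TM2to1.trInit (Γ := fun _ => PartrecToTM2.Γ') PartrecToTM2.K'.main
        (PartrecToTM2.trList [2 ^ n]) := by
    have hrev : (PartrecToTM2.trList [2 ^ n]).reverse =
        .cons :: .bit1 :: List.replicate n PartrecToTM2.Γ'.bit0 := by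
      simp [PartrecToTM2.trList, trNat_two_pow]
    rw [TM2to1.trInit, hrev]
    change bottom :: letter .bit1 :: List.replicate n (letter .bit0) =
      bottom :: letter .bit1 :: (List.replicate n .bit0).map letter
    rw [List.map_replicate]
  have h₂ : (TM2.init .main (PartrecToTM2.trList [2 ^ n]) :
      TM2.Cfg (fun _ : PartrecToTM2.K' => PartrecToTM2.Γ') PartrecToTM2.Λ' (Option PartrecToTM2.Γ'))
      = PartrecToTM2.init c [2 ^ n] := by
    rw [TM2.init, PartrecToTM2.init]
    congr 1
    funext k
    cases k <;> rfl
  rw [h₁, TM1to0.tr_eval]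
  refine (TM2to1.tr_eval_dom _ _ _).trans ?_
  change (StateTransition.eval (TM2.step PartrecToTM2.tr) (TM2.init .main _)).Dom ↔ _
  rw [h₂, PartrecToTM2.tr_eval]
  have := hc ⟨[2 ^ n], rfl⟩
  rw [this]
  rfl

/-! ### Computability of the reduction -/

theorem primrec_replicate {α β : Type*} [Primcodable α] [Primcodable β] {f : α → ℕ} {g : α → β}
    (hf : Primrec f) (hg : Primrec g) : Primrec fun a => List.replicate (f a) (g a) :=
  (Primrec.list_map (Primrec.list_range.comp hf) (hg.comp Primrec.fst).to₂).of_eq fun a => by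
    simp

theorem primrec_pairKey (A : Type*) [Primcodable A] [Finite A] :
    Primrec (pairKey : List A × List A → Key A) := by
  have hl : Primrec (Atom.letter : A → Atom A) := Primrec.dom_finite _
  exact Primrec.list_append.comp
    (Primrec.list_append.comp
      (Primrec.list_map Primrec.fst (hl.comp Primrec.snd).to₂)
      (Primrec.list_map (Primrec.list_reverse.comp Primrec.snd) (hl.comp Primrec.snd).to₂))
    (Primrec.list_map Primrec.snd (Primrec.const _).to₂)

open Classical in
theorem primrec_pairInput (A : Type*) [Primcodable A] [Finite A] :
    Primrec (pairInput : List (List A × List A) → LKInput A) :=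
  Primrec.subtype_mk (Primrec.list_map Primrec.id ((primrec_pairKey A).comp Primrec.snd).to₂)

theorem primrec_encodePair {S A : Type*} [Primcodable S] [Finite S] [Primcodable A]
    (φ : S → List A) : Primrec (encodePair φ) := by
  have hφ : Primrec φ := Primrec.dom_finite _
  exact Primrec.pair (Primrec.list_flatMap Primrec.fst (hφ.comp Primrec.snd).to₂)
    (Primrec.list_flatMap Primrec.snd (hφ.comp Primrec.snd).to₂)

theorem primrec_startTile {S : Type*} [Primcodable S] [Finite S] :
    Primrec (startTile : List S → _) := by
  have : Primrec fun a : S => (Sum.inl (a, true) : TileLetter S) := Primrec.dom_finite _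
  exact Primrec.pair (Primrec.const _) (Primrec.list_cons.comp (Primrec.const _)
    (Primrec.list_map Primrec.id (this.comp Primrec.snd).to₂))

theorem finite_tiles {S : Type*} [Finite S] {R : Set (List S × List S)} (hR : R.Finite)
    (t : List S) : {p | Tile R t p}.Finite := by
  have h₁ : (Set.range fun q : Bool × S => (colour q.1 [q.2], colour (!q.1) [q.2])).Finite :=
    Set.finite_range _
  have h₂ : ((fun q : Bool × List S × List S => (colour q.1 q.2.1, colour (!q.1) q.2.2)) ''
    (Set.univ ×ˢ R)).Finite := (Set.finite_univ.prod hR).image _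
  have h₃ : (Set.range fun c : Bool =>
      (colour c t ++ [endMarker], [(endMarker : TileLetter S)])).Finite :=
    Set.finite_range _
  refine ((h₁.union h₂).union h₃).subset ?_
  rintro _ (⟨c, a⟩ | ⟨c, h⟩ | c)
  · exact .inl (.inl ⟨(c, a), rfl⟩)
  · exact .inl (.inr ⟨(c, _), ⟨trivial, h⟩, rfl⟩)
  · exact .inr ⟨c, rfl⟩

/-- If emptiness of intersection is decidable over the alphabet `A`, it decides derivability of a
fixed word `t` in a fixed semi-Thue system, from words which are computable from a parameter. -/
theorem computablePred_reflTransGen (A : Type*) [Finite A] [Nontrivial A] [Primcodable A]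
    (h : ComputablePred fun K : LKInput A × LKInput A =>
      K.1.keyboard.language ⊓ K.2.keyboard.language = ⊥)
    {S : Type*} [Finite S] [Primcodable S] {R : Set (List S × List S)} (hR : R.Finite)
    (hR' : ∀ l r, (l, r) ∈ R → l ≠ [] ∧ r ≠ []) {t : List S} (ht : t ≠ []) {w : ℕ → List S}
    (hw : Primrec w) (hw' : ∀ n, w n ≠ []) :
    ComputablePred fun n => Relation.ReflTransGen (Rewrites R) (w n) t := by
  obtain ⟨φ, a, b, k, hφ⟩ := exists_isBlockCode (TileLetter S) A
  let T := (finite_tiles hR t).toFinset.toList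
  let F (n : ℕ) : LKInput A × LKInput A :=
    (pairInput ((startTile (w n) :: T).map (encodePair φ)), pairInput (diagonalPairs A))
  have hF : Primrec F := by
    refine Primrec.pair ((primrec_pairInput A).comp ?_) (Primrec.const _)
    exact Primrec.list_map
      (Primrec.list_cons.comp (primrec_startTile.comp hw) (Primrec.const T))
      ((primrec_encodePair φ).comp Primrec.snd).to₂
  refine ComputablePred.computable_of_manyOneReducible ⟨F, hF.to_comp, fun n => ?_⟩ h.not
  change Relation.ReflTransGen _ _ _ ↔ ¬ (_ = _)
  rw [hφ.inf_language_eq_bot_iff, not_not, ← hasMatch_iff_reflTransGen hR' ht (hw' n)]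
  simp [T]

end Keyboard

open Keyboard in
theorem mainTheorem11 (A : Type*) [Finite A] [Nontrivial A] [Primcodable A] :
    ¬ ComputablePred fun K : Keyboard.LKInput A × Keyboard.LKInput A =>
      K.1.keyboard.language ⊓ K.2.keyboard.language = ⊥ := by
  intro h
  obtain ⟨Γ, Λ, _, _, _, M, S, x, g, hfin, hS, hM⟩ := exists_machine_not_computablePred
  have := hfin.to_subtype
  let : Primcodable (TapeLetter Γ S) := Primcodable.ofEquiv _ (Finite.equivFin (TapeLetter Γ S))
  let q₀ : S := ⟨default, hS.1⟩
  refine hM ?_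
  have hw : Primrec fun n => configWord [] q₀ (x ++ List.replicate n g) := by
    have : Primrec fun n : ℕ => TapeLetter.leftEnd :: TapeLetter.state q₀ :: x.map .symbol ++
        List.replicate n (.symbol g) ++ [TapeLetter.rightEnd] :=
      Primrec.list_append.comp (Primrec.list_append.comp (Primrec.const _)
        (primrec_replicate Primrec.id (Primrec.const _))) (Primrec.const _)
    exact this.of_eq fun n => by simp [configWord]
  refine (computablePred_reflTransGen A h (finite_machineRules (M := M) hfin)
    ne_nil_of_mem_machineRules (t := haltWord) (by simp [haltWord]) hw
    (by simp [configWord])).of_eq fun n => ?_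
  rw [reflTransGen_haltWord_iff hS]
  rfl
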